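/- Let $f$ be analytic on an open neighbourhood $\Omega\subset\mathbb{C}$ of the unit circle, with $f(z)$ real and $f(z)>0$ for all $|z|=1$. For $m\ge 1$ let $\mathcal{D}_m=\{z\in\mathbb{C}: z^m=1\}$, and define the discrete and continuous Toeplitz determinants $$\mathbf{T}_n(f,\mathcal{D}_m)=\det\Big[\frac1m\sum_{z\in\mathcal{D}_m}z^{-j+k}f(z)\Big]_{j,k=0}^{n-1},\qquad \mathcal{T}_n(f)=\det\Big[\int_{|z|=1}z^{-j+k}f(z)\frac{dz}{2\pi i z}\Big]_{j,k=0}^{n-1},$$ where the circle is positively oriented. Then there is a constant $c>0$, depending only on $f$, such that $$\mathbf{T}_n(f,\mathcal{D}_m)=\mathcal{T}_n(f)\big(1+O(e^{-c(m-n)})\big)\qquad\text{as } m-n\to\infty \text{ and } n\to\infty .$$ That is, there are constants $c>0$, $C$ and $N$, depending only on $f$, such that for all integers $n\ge N$ and $m\ge n+N$ one has $\mathbf{T}_n(f,\mathcal{D}_m)=\mathcal{T}_n(f)(1+E_{n,m})$ with $|E_{n,m}|\le C e^{-c(m-n)}$. -/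

import Mathlib

/-- The discrete Toeplitz determinant
`𝐓_n(f, D) = det [ |D|⁻¹ ∑_{z ∈ D} z^{-j+k} f(z) ]_{j,k=0}^{n-1}`
of a function `f` on a finite set `D` of complex numbers. -/
noncomputable def discreteToeplitzDet (n : ℕ) (f : ℂ → ℂ) (D : Finset ℂ) : ℂ :=
  Matrix.det (Matrix.of fun j k : Fin n =>
    (D.card : ℂ)⁻¹ * ∑ z ∈ D, z ^ (-(j : ℤ) + (k : ℤ)) * f z)

/-- The continuous Toeplitz determinant
`𝒯_n(f) = det [ ∮_{|z|=1} z^{-j+k} f(z) dz/(2πiz) ]_{j,k=0}^{n-1}`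
of a symbol `f` on the unit circle (positively oriented). -/
noncomputable def continuousToeplitzDet (n : ℕ) (f : ℂ → ℂ) : ℂ :=
  Matrix.det (Matrix.of fun j k : Fin n =>
    ∮ z in C(0, 1), z ^ (-(j : ℤ) + (k : ℤ)) * f z * (2 * (Real.pi : ℂ) * Complex.I * z)⁻¹)

/-- The set `D_m = {z ∈ ℂ : z^m = 1}` of `m`-th roots of unity, for `m ≥ 1`
(for `m = 0` the value is `∅`). -/
noncomputable def unityRoots (m : ℕ) : Finset ℂ :=
  Polynomial.nthRootsFinset m (1 : ℂ)

theorem mem_unityRoots {m : ℕ} (hm : 0 < m) (z : ℂ) : z ∈ unityRoots m ↔ z ^ m = 1 :=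
  Polynomial.mem_nthRootsFinset hm 1

/-! Analyticity in an annulus makes the Fourier coefficients decay geometrically. Averaging over the
`m`-th roots of unity folds together the coefficients congruent mod `m`, so each entry of the
discrete matrix differs from the continuous one by a sum over `l ≡ j - k` mod `m`, `l ≠ j - k`, of
size `s ^ (m - |j - k|)` up to a constant (`norm_aliasing_le`). This error `R` is small, and is
largest near the two off-diagonal corners.

Positivity of `f` bounds the Toeplitz form below by `δ = min f` (`toeplitz_coercive`), so the
entries of `T⁻¹` are at most `δ⁻¹`, uniformly in `n`. The ratio of determinants is `det (1 + T⁻¹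
R)`, controlled by an entrywise `ℓ¹` norm. To avoid losing powers of `n`, `R` is dominated by
weights concentrated at both ends of the index range, whose sum is bounded independently of `n`. -/

/-! ### Perturbation of determinants of coercive matrices -/

/-- The Leibniz expansion gives an entrywise `ℓ¹` bound for determinants close to one. -/
theorem norm_det_one_add_sub_one_le {n : Type*} [Fintype n] [DecidableEq n]
    (A : Matrix n n ℂ) :
    ‖(1 + A).det - 1‖ ≤ Real.exp (∑ j, ∑ k, ‖A j k‖) - 1 := by
  have hprod : ∀ a b : n → ℂ, ‖∏ i, (a i + b i) - ∏ i, a i‖ ≤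
      ∏ i, (‖a i‖ + ‖b i‖) - ∏ i, ‖a i‖ := by
    intro a b
    -- Expanding over subsets, the full subset contributes exactly the subtracted product; the
    -- remaining terms compare one by one.
    rw [Fintype.prod_add, Fintype.prod_add,
      ← Finset.add_sum_erase _ _ (Finset.mem_univ (Finset.univ : Finset n)),
      ← Finset.add_sum_erase _ _ (Finset.mem_univ (Finset.univ : Finset n))]
    simp only [Finset.compl_univ, Finset.prod_empty, mul_one, add_sub_cancel_left]
    refine (norm_sum_le _ _).trans (Finset.sum_le_sum fun s _ => ?_)
    simp [norm_prod]
  have hdet : (1 + A).det - 1 = ∑ σ : Equiv.Perm n, (Equiv.Perm.sign σ : ℤ) *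
      (∏ i, ((1 : Matrix n n ℂ) (σ i) i + A (σ i) i) - ∏ i, (1 : Matrix n n ℂ) (σ i) i) := by
    conv_lhs => rw [← Matrix.det_one (n := n) (R := ℂ), Matrix.det_apply', Matrix.det_apply']
    simp only [mul_sub, Finset.sum_sub_distrib, Matrix.add_apply]
  have hone : ∑ σ : Equiv.Perm n, ∏ i, ‖(1 : Matrix n n ℂ) (σ i) i‖ = 1 := by
    rw [Finset.sum_eq_single (Equiv.refl n)]
    · exact Finset.prod_eq_one fun i _ => by rw [Equiv.refl_apply, Matrix.one_apply_eq, norm_one]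
    · intro σ _ hσ
      obtain ⟨i, hi⟩ : ∃ i, σ i ≠ i := by
        by_contra! h
        exact hσ (Equiv.ext h)
      exact Finset.prod_eq_zero (Finset.mem_univ i) (by simp [Matrix.one_apply_ne hi])
    · simp
  let B : n → n → ℝ := fun j i => ‖(1 : Matrix n n ℂ) j i‖ + ‖A j i‖
  -- Permutations are among all maps `n → n`, and the sum over all maps factors into column sums.
  have hperm : ∑ σ : Equiv.Perm n, ∏ i, B (σ i) i ≤ ∏ i, ∑ j, B j i := by
    rw [Finset.prod_univ_sum, Fintype.piFinset_univ]
    refine le_of_eq_of_le (Finset.sum_map Finset.univ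
      ⟨fun σ : Equiv.Perm n => (σ : n → n), DFunLike.coe_injective⟩
      (fun g : n → n => ∏ i, B (g i) i)).symm ?_
    exact Finset.sum_le_sum_of_subset_of_nonneg (Finset.subset_univ _)
      fun g _ _ => Finset.prod_nonneg fun i _ => by positivity
  have hcol : ∏ i, ∑ j, B j i ≤ Real.exp (∑ j, ∑ k, ‖A j k‖) := by
    rw [Finset.sum_comm]
    refine le_trans (le_of_eq ?_) (Real.prod_one_add_le_exp_sum Finset.univ
      (f := fun i => ∑ j, ‖A j i‖) ?_)
    · refine Finset.prod_congr rfl fun i _ => ?_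
      simp only [B, Finset.sum_add_distrib]
      congr 1
      rw [Finset.sum_eq_single i] <;> simp +contextual
    · intros; positivity
  rw [hdet]
  calc _ ≤ ∑ σ : Equiv.Perm n, (∏ i, B (σ i) i - ∏ i, ‖(1 : Matrix n n ℂ) (σ i) i‖) := by
        refine (norm_sum_le _ _).trans (Finset.sum_le_sum fun σ _ => ?_)
        rw [norm_mul]
        have : ‖((Equiv.Perm.sign σ : ℤ) : ℂ)‖ = 1 := by
          rcases Int.units_eq_one_or (Equiv.Perm.sign σ) with h | h <;> simp [h]
        rw [this, one_mul]
        exact hprod _ _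
    _ ≤ _ := by
        rw [Finset.sum_sub_distrib, hone]
        linarith

/-- A coercive matrix is invertible. -/
theorem isUnit_det_of_coercive {n : Type*} [Fintype n] [DecidableEq n] {T : Matrix n n ℂ}
    {δ : ℝ} (hδ : 0 < δ)
    (hT : ∀ x : n → ℂ, δ * ∑ j, ‖x j‖ ^ 2 ≤ (star x ⬝ᵥ T.mulVec x).re) : IsUnit T.det := by
  rw [isUnit_iff_ne_zero]
  intro h
  obtain ⟨x, hx, hTx⟩ := Matrix.exists_mulVec_eq_zero_iff.mpr h
  have := hT x
  rw [hTx, dotProduct_zero, Complex.zero_re] at this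
  obtain ⟨i, hi⟩ := Function.ne_iff.mp hx
  have h2 : ‖x i‖ ^ 2 ≤ ∑ j, ‖x j‖ ^ 2 :=
    Finset.single_le_sum (f := fun j => ‖x j‖ ^ 2) (fun _ _ => by positivity) (Finset.mem_univ i)
  have h3 : 0 < ‖x i‖ ^ 2 := by have := norm_pos_iff.mpr hi; positivity
  nlinarith

/-- The entries of the inverse of a coercive matrix are bounded by the inverse of the
coercivity constant. -/
theorem norm_inv_apply_le_of_coercive {n : Type*} [Fintype n] [DecidableEq n] {T : Matrix n n ℂ}
    {δ : ℝ} (hδ : 0 < δ)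
    (hT : ∀ x : n → ℂ, δ * ∑ j, ‖x j‖ ^ 2 ≤ (star x ⬝ᵥ T.mulVec x).re) (j i : n) :
    ‖T⁻¹ j i‖ ≤ δ⁻¹ := by
  have hu := isUnit_det_of_coercive hδ hT
  set x : n → ℂ := T⁻¹.mulVec (Pi.single i 1) with hx
  have hxj : ∀ k, x k = T⁻¹ k i := fun k => by simp [hx]
  have hTx : T.mulVec x = Pi.single i 1 := by
    rw [hx, Matrix.mulVec_mulVec, Matrix.mul_nonsing_inv _ hu, Matrix.one_mulVec]
  have h := hT x
  rw [hTx] at h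
  have hre : (star x ⬝ᵥ Pi.single i (1 : ℂ)).re ≤ ‖x i‖ := by
    simpa using Complex.re_le_norm (x i)
  have hk : ∀ k, ‖x k‖ ^ 2 ≤ ∑ j, ‖x j‖ ^ 2 := fun k =>
    Finset.single_le_sum (f := fun j => ‖x j‖ ^ 2) (fun _ _ => by positivity) (Finset.mem_univ k)
  -- For the column `x = T⁻¹ eᵢ`, coercivity reads `δ ∑ ‖x k‖² ≤ ‖x i‖`. This bounds the diagonal
  -- entry first, and then every entry of the column.
  have hi : ‖x i‖ ≤ δ⁻¹ := by
    rw [← one_div, le_div_iff₀ hδ]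
    by_contra! hc
    have h1 := mul_le_mul_of_nonneg_left (hk i) hδ.le
    have h2 : 0 < ‖x i‖ := by
      by_contra! h0
      nlinarith [norm_nonneg (x i)]
    nlinarith
  rw [← hxj j]
  by_contra! hc
  have h1 := hk j
  have h4 : δ * δ⁻¹ = 1 := mul_inv_cancel₀ hδ.ne'
  have h5 : 0 < δ⁻¹ := inv_pos.mpr hδ
  have h6 : δ * ‖x j‖ ^ 2 ≤ δ⁻¹ := by nlinarith
  have h7 : δ * (δ⁻¹ * δ⁻¹) < δ * ‖x j‖ ^ 2 := by
    apply mul_lt_mul_of_pos_left _ hδ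
    nlinarith
  nlinarith

/-- Relative perturbation of the determinant of a coercive matrix by a matrix whose entries
are dominated by a weight `ε * v j * v k ^ 2`. -/
theorem exists_det_add_eq_det_mul_of_coercive {n : Type*} [Fintype n] [DecidableEq n]
    {T R : Matrix n n ℂ} {δ ε : ℝ} (hδ : 0 < δ)
    (hT : ∀ x : n → ℂ, δ * ∑ j, ‖x j‖ ^ 2 ≤ (star x ⬝ᵥ T.mulVec x).re)
    {v : n → ℝ} (hv : ∀ j, 0 < v j) (hR : ∀ j k, ‖R j k‖ ≤ ε * v j * v k ^ 2) :
    ∃ E : ℂ, ‖E‖ ≤ Real.exp (δ⁻¹ * ε * (∑ j, v j) ^ 3) - 1 ∧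
      (T + R).det = T.det * (1 + E) := by
  have hu := isUnit_det_of_coercive hδ hT
  set A : Matrix n n ℂ := T⁻¹ * R with hA
  have hdet : (T + R).det = T.det * (1 + A).det := by
    rw [← Matrix.det_mul, mul_add, mul_one, hA, Matrix.mul_nonsing_inv_cancel_left _ _ hu]
  have hAjk : ∀ j k, ‖A j k‖ ≤ δ⁻¹ * ε * (∑ i, v i) * v k ^ 2 := by
    intro j k
    rw [hA, Matrix.mul_apply]
    calc _ ≤ ∑ i, δ⁻¹ * (ε * v i * v k ^ 2) := by
          refine (norm_sum_le _ _).trans (Finset.sum_le_sum fun i _ => ?_)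
          rw [norm_mul]
          exact mul_le_mul (norm_inv_apply_le_of_coercive hδ hT j i) (hR i k) (norm_nonneg _)
            (inv_pos.mpr hδ).le
      _ = _ := by
          rw [Finset.mul_sum, Finset.sum_mul]
          exact Finset.sum_congr rfl fun i _ => by ring
  -- The bound on `A j k` decays only in `k`. Conjugation by the weights keeps the determinant and
  -- turns `v k ^ 2` into `v j * v k`, which is summable in both indices.
  let D : Matrix n n ℂ := Matrix.diagonal fun j => (v j : ℂ)
  have hD : IsUnit D := by
    rw [Matrix.isUnit_iff_isUnit_det, Matrix.det_diagonal, isUnit_iff_ne_zero]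
    exact Finset.prod_ne_zero_iff.mpr fun j _ => by exact_mod_cast (hv j).ne'
  have hconj : (1 + D * A * D⁻¹).det = (1 + A).det := by
    rw [← Matrix.det_conj hD (1 + A), mul_add, add_mul, mul_one,
      Matrix.mul_nonsing_inv _ ((Matrix.isUnit_iff_isUnit_det _).mp hD)]
  have hDinv : D⁻¹ = Matrix.diagonal fun j => ((v j : ℂ))⁻¹ := by
    apply Matrix.inv_eq_right_inv
    rw [Matrix.diagonal_mul_diagonal, ← Matrix.diagonal_one]
    congr 1
    ext j
    exact mul_inv_cancel₀ (by exact_mod_cast (hv j).ne')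
  refine ⟨(1 + A).det - 1, ?_, by rw [hdet]; ring⟩
  rw [← hconj]
  refine (norm_det_one_add_sub_one_le _).trans ?_
  gcongr
  calc _ ≤ ∑ j, ∑ k, δ⁻¹ * ε * (∑ i, v i) * (v j * v k) := by
        refine Finset.sum_le_sum fun j _ => Finset.sum_le_sum fun k _ => ?_
        rw [hDinv, Matrix.mul_diagonal, Matrix.diagonal_mul, norm_mul, norm_mul, norm_inv,
          Complex.norm_of_nonneg (hv j).le, Complex.norm_of_nonneg (hv k).le]
        calc v j * ‖A j k‖ * (v k)⁻¹ ≤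
            v j * (δ⁻¹ * ε * (∑ i, v i) * v k ^ 2) * (v k)⁻¹ := by
              have := hv j; have := hv k; have := hAjk j k
              gcongr
          _ = _ := by have := (hv k).ne'; field_simp
    _ = _ := by
        simp_rw [← Finset.mul_sum]
        rw [← Finset.sum_mul]
        ring

/-! ### Fourier coefficients: decay and inversion -/

/-- The Fourier coefficients of `f` on the unit circle, as contour integrals. -/
noncomputable def circleCoeff (f : ℂ → ℂ) (l : ℤ) : ℂ :=
  ∮ z in C(0, 1), z ^ (-l) * f z * (2 * (Real.pi : ℂ) * Complex.I * z)⁻¹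

theorem circleCoeff_eq_intervalIntegral (f : ℂ → ℂ) (l : ℤ) :
    circleCoeff f l = (2 * Real.pi : ℂ)⁻¹ *
      ∫ θ in (0 : ℝ)..2 * Real.pi, circleMap 0 1 θ ^ (-l) * f (circleMap 0 1 θ) := by
  rw [circleCoeff, circleIntegral, ← intervalIntegral.integral_const_mul]
  congr 1
  ext θ
  have h0 : circleMap 0 1 θ ≠ 0 := circleMap_ne_center one_ne_zero
  have hpi : (Real.pi : ℂ) ≠ 0 := by exact_mod_cast Real.pi_ne_zero
  have hI := Complex.I_ne_zero
  rw [deriv_circleMap, smul_eq_mul]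
  field_simp

/-- Makes the Toeplitz matrix of the symbol `1` the identity, from which Parseval's identity for
polynomials follows. -/
theorem circleCoeff_one (l : ℤ) : circleCoeff (fun _ => 1) l = if l = 0 then 1 else 0 := by
  have h : circleCoeff (fun _ => 1) l =
      (2 * (Real.pi : ℂ) * Complex.I)⁻¹ * ∮ z in C(0, 1), (z - 0) ^ (-l - 1) := by
    rw [circleCoeff, ← circleIntegral.integral_const_mul]
    refine circleIntegral.integral_congr zero_le_one fun z hz => ?_
    have hz0 : z ≠ 0 := by
      rintro rfl
      simp at hz
    simp only [sub_zero, mul_one]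
    rw [zpow_sub_one₀ hz0, mul_inv]
    ring
  rw [h]
  split_ifs with hl
  · subst hl
    have := circleIntegral.integral_sub_center_inv 0 (R := 1) one_ne_zero
    simp only [neg_zero, zero_sub, zpow_neg_one, this]
    exact inv_mul_cancel₀ Complex.two_pi_I_ne_zero
  · rw [circleIntegral.integral_sub_zpow_of_ne (by omega), mul_zero]

theorem exists_annulus_subset_of_sphere_subset {Ω : Set ℂ} (hΩ : IsOpen Ω)
    (hcircle : Metric.sphere (0 : ℂ) 1 ⊆ Ω) :
    ∃ r : ℝ, 0 < r ∧ r < 1 ∧ ∀ z : ℂ, r ≤ ‖z‖ → ‖z‖ ≤ r⁻¹ → z ∈ Ω := by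
  obtain ⟨δ, hδ, hsub⟩ :=
    (isCompact_sphere (0 : ℂ) 1).exists_cthickening_subset_open hΩ hcircle
  refine ⟨(1 + δ)⁻¹, by positivity, inv_lt_one_of_one_lt₀ (by linarith), fun z h1 h2 => ?_⟩
  rw [inv_inv] at h2
  have hz : 0 < ‖z‖ := lt_of_lt_of_le (by positivity) h1
  have hz0 : (‖z‖ : ℂ) ≠ 0 := by exact_mod_cast hz.ne'
  have h3 : 1 - δ ≤ ‖z‖ := by
    refine le_trans ?_ h1
    rw [← one_div, le_div_iff₀ (by positivity)]
    nlinarith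
  apply hsub
  refine Metric.mem_cthickening_of_dist_le z (z / ‖z‖) δ _ (by simp [hz.ne']) ?_
  have : z - z / ‖z‖ = (z / ‖z‖) * ((‖z‖ - 1 : ℝ) : ℂ) := by
    push_cast
    field_simp
  rw [dist_eq_norm, this, norm_mul, norm_div, Complex.norm_real, norm_norm, div_self hz.ne',
    one_mul, Complex.norm_real, Real.norm_eq_abs, abs_le]
  constructor <;> linarith

/-- The coefficients of a function analytic on an annulus decay geometrically. -/
theorem norm_circleCoeff_le_of_annulus {f : ℂ → ℂ} {r : ℝ} (hr0 : 0 < r) (hr1 : r < 1)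
    (hf : ∀ z : ℂ, r ≤ ‖z‖ → ‖z‖ ≤ r⁻¹ → AnalyticAt ℂ f z) :
    ∃ M : ℝ, 0 ≤ M ∧ ∀ l : ℤ, ‖circleCoeff f l‖ ≤ M * r ^ l.natAbs := by
  have hr1' : 1 < r⁻¹ := (one_lt_inv₀ hr0).mpr hr1
  obtain ⟨M, hM⟩ : ∃ M, ∀ z ∈ Metric.closedBall (0 : ℂ) r⁻¹ \ Metric.ball 0 r, ‖f z‖ ≤ M := by
    refine ((isCompact_closedBall (0 : ℂ) r⁻¹).diff Metric.isOpen_ball).exists_bound_of_continuousOn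
      fun z hz => ?_
    simp only [Set.mem_sdiff, mem_closedBall_zero_iff, mem_ball_zero_iff, not_lt] at hz
    exact (hf z hz.2 hz.1).continuousAt.continuousWithinAt
  have hM' : ∀ z : ℂ, r ≤ ‖z‖ → ‖z‖ ≤ r⁻¹ → ‖f z‖ ≤ M := fun z h1 h2 =>
    hM z (by simp [h1, h2])
  have hM0 : 0 ≤ M := (norm_nonneg _).trans (hM' 1 (by simpa using hr1.le) (by simpa using hr1'.le))
  have han : ∀ l : ℤ, ∀ z : ℂ, r ≤ ‖z‖ → ‖z‖ ≤ r⁻¹ → AnalyticAt ℂ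
      (fun z => z ^ (-l) * f z * (2 * (Real.pi : ℂ) * Complex.I * z)⁻¹) z := by
    intro l z h1 h2
    have hz : z ≠ 0 := norm_pos_iff.mp (hr0.trans_le h1)
    have h3 : 2 * (Real.pi : ℂ) * Complex.I * z ≠ 0 := mul_ne_zero Complex.two_pi_I_ne_zero hz
    exact ((analyticAt_id.zpow hz).mul (hf z h1 h2)).mul
      ((analyticAt_const.mul analyticAt_id).inv h3)
  have hshift : ∀ l : ℤ, ∀ a b : ℝ, r ≤ a → a ≤ b → b ≤ r⁻¹ →
      (∮ z in C(0, b), z ^ (-l) * f z * (2 * (Real.pi : ℂ) * Complex.I * z)⁻¹) =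
      ∮ z in C(0, a), z ^ (-l) * f z * (2 * (Real.pi : ℂ) * Complex.I * z)⁻¹ := by
    intro l a b ha hab hb
    refine Complex.circleIntegral_eq_of_differentiable_on_annulus_off_countable
      (hr0.trans_le ha) hab Set.countable_empty (fun z hz => ?_) (fun z hz => ?_)
    · simp only [Set.mem_sdiff, mem_closedBall_zero_iff, mem_ball_zero_iff, not_lt] at hz
      exact (han l z (ha.trans hz.2) (hz.1.trans hb)).continuousAt.continuousWithinAt
    · simp only [Set.sdiff_empty, Set.mem_sdiff, mem_closedBall_zero_iff, mem_ball_zero_iff,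
        not_le] at hz
      exact (han l z (ha.trans hz.2.le) (hz.1.le.trans hb)).differentiableAt
  have hbound : ∀ l : ℤ, ∀ a : ℝ, r ≤ a → a ≤ r⁻¹ →
      ‖∮ z in C(0, a), z ^ (-l) * f z * (2 * (Real.pi : ℂ) * Complex.I * z)⁻¹‖ ≤
        M * a ^ (-l) := by
    intro l a h1 h2
    have ha : 0 < a := hr0.trans_le h1
    refine (circleIntegral.norm_integral_le_of_norm_le_const ha.le
      (C := a ^ (-l) * M * (2 * Real.pi * a)⁻¹) fun z hz => ?_).trans (le_of_eq ?_)
    · rw [mem_sphere_zero_iff_norm] at hz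
      have := hM' z (hz ▸ h1) (hz ▸ h2)
      rw [norm_mul, norm_mul, norm_inv, norm_zpow, hz]
      simp only [norm_mul, hz, Complex.norm_I, Complex.norm_real, Complex.norm_ofNat,
        Real.norm_of_nonneg Real.pi_pos.le, mul_one]
      gcongr
    · have := Real.pi_pos.ne'
      field_simp
  refine ⟨M, hM0, fun l => ?_⟩
  -- The contour moves to the edge of the annulus where `z ^ (-l)` is smallest: outward for `l ≥ 0`,
  -- inward for `l ≤ 0`.
  rcases le_total 0 l with hl | hl
  · rw [circleCoeff, ← hshift l 1 r⁻¹ hr1.le hr1'.le le_rfl]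
    refine (hbound l r⁻¹ (hr1.trans hr1').le le_rfl).trans (le_of_eq ?_)
    lift l to ℕ using hl
    simp
  · rw [circleCoeff, hshift l r 1 le_rfl hr1.le hr1'.le]
    refine (hbound l r le_rfl (hr1.trans hr1').le).trans (le_of_eq ?_)
    obtain ⟨k, rfl⟩ : ∃ k : ℕ, l = -k := ⟨l.natAbs, by omega⟩
    simp

theorem summable_pow_natAbs {r : ℝ} (hr0 : 0 ≤ r) (hr1 : r < 1) :
    Summable fun l : ℤ => r ^ l.natAbs :=
  Summable.of_nat_of_neg (by simpa using summable_geometric_of_lt_one hr0 hr1)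
    (by simpa using summable_geometric_of_lt_one hr0 hr1)

/-- A continuous function on the circle with summable coefficients is the sum of its
Fourier series. -/
theorem hasSum_circleCoeff {f : ℂ → ℂ} (hf : ContinuousOn f (Metric.sphere 0 1))
    (hs : Summable (circleCoeff f)) {z : ℂ} (hz : ‖z‖ = 1) :
    HasSum (fun l : ℤ => circleCoeff f l * z ^ l) (f z) := by
  have : Fact (0 < 2 * Real.pi) := ⟨Real.two_pi_pos⟩
  let F : C(AddCircle (2 * Real.pi), ℂ) :=
    ⟨fun x => f (AddCircle.toCircle x), hf.comp_continuous
      (continuous_subtype_val.comp AddCircle.continuous_toCircle)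
      fun x => mem_sphere_zero_iff_norm.mpr (Circle.norm_coe _)⟩
  have hexp : ∀ θ : ℝ, ((AddCircle.toCircle (θ : AddCircle (2 * Real.pi)) : Circle) : ℂ) =
      circleMap 0 1 θ := by
    intro θ
    rw [AddCircle.toCircle_apply_mk, div_self Real.two_pi_pos.ne', one_mul, Circle.coe_exp]
    simp [circleMap]
  have hfour : ∀ (l : ℤ) (θ : ℝ), fourier l (θ : AddCircle (2 * Real.pi)) =
      circleMap 0 1 θ ^ l := by
    intro l θ
    rw [fourier_apply, AddCircle.toCircle_zsmul, Circle.coe_zpow, hexp]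
  have hcoeff : fourierCoeff F = circleCoeff f := by
    ext l
    rw [fourierCoeff_eq_intervalIntegral F l 0, circleCoeff_eq_intervalIntegral, zero_add,
      Complex.real_smul]
    congr 1
    · simp
    · refine intervalIntegral.integral_congr fun θ _ => ?_
      simp only [hfour, smul_eq_mul, F, ContinuousMap.coe_mk, hexp]
  have h := has_pointwise_sum_fourier_series_of_summable (f := F) (hcoeff ▸ hs)
    ((z.arg : ℝ) : AddCircle (2 * Real.pi))
  have hzarg : circleMap 0 1 z.arg = z := by
    have := Complex.norm_mul_exp_arg_mul_I z
    rw [hz] at this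
    simpa [circleMap] using this
  rw [hcoeff] at h
  simpa only [hfour, hzarg, smul_eq_mul, F, ContinuousMap.coe_mk, hexp] using h

/-! ### Aliasing on the roots of unity -/

theorem card_unityRoots {m : ℕ} (hm : 0 < m) : (unityRoots m).card = m :=
  (Complex.isPrimitiveRoot_exp m hm.ne').card_nthRootsFinset

/-- Orthogonality of characters on the roots of unity. -/
theorem sum_unityRoots_zpow {m : ℕ} (hm : 0 < m) (l : ℤ) :
    ((unityRoots m).card : ℂ)⁻¹ * ∑ z ∈ unityRoots m, z ^ l = if (m : ℤ) ∣ l then 1 else 0 := by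
  have hm0 : (m : ℂ) ≠ 0 := by exact_mod_cast hm.ne'
  rw [card_unityRoots hm]
  split_ifs with hl
  · obtain ⟨t, rfl⟩ := hl
    rw [Finset.sum_congr rfl fun z hz => by
      rw [zpow_mul, zpow_natCast, (mem_unityRoots hm z).mp hz, one_zpow]]
    simp [card_unityRoots hm, hm0]
  · have hprim := Complex.isPrimitiveRoot_exp m hm.ne'
    set w := Complex.exp (2 * Real.pi * Complex.I / m)
    have hw0 : w ≠ 0 := Complex.exp_ne_zero _
    have hw : w ^ l ≠ 1 := fun h => hl ((hprim.zpow_eq_one_iff_dvd l).mp h)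
    -- Multiplication by `w` permutes the roots of unity.
    have hmul : w ^ l * ∑ z ∈ unityRoots m, z ^ l = ∑ z ∈ unityRoots m, z ^ l := by
      rw [Finset.mul_sum]
      refine Finset.sum_nbij' (fun z => w * z) (fun z => w⁻¹ * z) ?_ ?_ ?_ ?_ ?_
      · intro z hz
        rw [mem_unityRoots hm] at hz ⊢
        rw [mul_pow, hz, hprim.pow_eq_one, one_mul]
      · intro z hz
        rw [mem_unityRoots hm] at hz ⊢
        rw [mul_pow, hz, inv_pow, hprim.pow_eq_one, inv_one, one_mul]
      · intro z _
        exact inv_mul_cancel_left₀ hw0 z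
      · intro z _
        exact mul_inv_cancel_left₀ hw0 z
      · intro z _
        exact (mul_zpow w z l).symm
    have h0 : (w ^ l - 1) * ∑ z ∈ unityRoots m, z ^ l = 0 := by rw [sub_mul, hmul]; ring
    rw [(mul_eq_zero.mp h0).resolve_left (sub_ne_zero.mpr hw), mul_zero]

/-- The aliasing error of the trapezoidal rule on the roots of unity. -/
theorem norm_aliasing_le {f : ℂ → ℂ} (hf : ContinuousOn f (Metric.sphere 0 1))
    {s M : ℝ} (hs0 : 0 < s) (hs1 : s < 1) (hM : 0 ≤ M)
    (hcoeff : ∀ l : ℤ, ‖circleCoeff f l‖ ≤ M * (s * s) ^ l.natAbs)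
    {m : ℕ} {q : ℤ} (hq : q.natAbs < m) :
    ‖((unityRoots m).card : ℂ)⁻¹ * ∑ z ∈ unityRoots m, z ^ (-q) * f z - circleCoeff f q‖ ≤
      M * (∑' l : ℤ, s ^ l.natAbs) * s ^ (m - q.natAbs) := by
  have hm : 0 < m := by omega
  have hss : s * s < 1 := by nlinarith
  have hsum : Summable (circleCoeff f) :=
    Summable.of_norm_bounded ((summable_pow_natAbs (by positivity) hss).mul_left M) hcoeff
  have hnorm : ∀ z ∈ unityRoots m, ‖z‖ = 1 := fun z hz =>
    Complex.norm_eq_one_of_pow_eq_one ((mem_unityRoots hm z).mp hz) hm.ne'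
  have h1 : HasSum (fun l : ℤ => ((unityRoots m).card : ℂ)⁻¹ *
      ∑ z ∈ unityRoots m, z ^ (-q) * (circleCoeff f l * z ^ l))
      (((unityRoots m).card : ℂ)⁻¹ * ∑ z ∈ unityRoots m, z ^ (-q) * f z) :=
    (hasSum_sum fun z hz => (hasSum_circleCoeff hf hsum (hnorm z hz)).mul_left _).mul_left _
  have h2 : HasSum (fun l : ℤ => circleCoeff f l * if (m : ℤ) ∣ l - q then 1 else 0)
      (((unityRoots m).card : ℂ)⁻¹ * ∑ z ∈ unityRoots m, z ^ (-q) * f z) := by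
    convert! h1 using 1
    ext l
    rw [← sum_unityRoots_zpow hm (l - q), mul_left_comm, Finset.mul_sum]
    congr 1
    refine Finset.sum_congr rfl fun z hz => ?_
    have hz0 : z ≠ 0 := norm_pos_iff.mp (by rw [hnorm z hz]; exact one_pos)
    rw [sub_eq_add_neg, zpow_add₀ hz0]
    ring
  have h3 := h2.sub (hasSum_ite_eq q (circleCoeff f q))
  have hS := (summable_pow_natAbs hs0.le hs1).hasSum
  refine le_trans (h3.norm_le_of_bounded (hS.mul_left (M * s ^ (m - q.natAbs))) fun l => ?_)
    (le_of_eq (by ring))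
  by_cases hlq : l = q
  · subst hlq
    simp
    positivity
  by_cases hd : (m : ℤ) ∣ l - q
  · simp only [hd, hlq, if_true, if_false, mul_one, sub_zero]
    -- A nonzero multiple `l - q` of `m` has size at least `m`. Of the two factors `s ^ |l|`, one
    -- then gives the decay and the other keeps the series summable.
    have h4 : m - q.natAbs ≤ l.natAbs := by
      have := Nat.le_of_dvd (by omega) (Int.natCast_dvd.mp hd)
      omega
    refine (hcoeff l).trans ?_
    rw [mul_pow, mul_assoc]
    have := pow_le_pow_of_le_one hs0.le hs1.le h4
    gcongr
  · simp [hd, hlq]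
    positivity

/-! ### Coercivity of the Toeplitz matrix -/

/-- The quadratic form of a Toeplitz matrix as an integral over the circle. -/
theorem toeplitz_quadraticForm {n : ℕ} {f : ℂ → ℂ} (hf : ContinuousOn f (Metric.sphere 0 1))
    (x : Fin n → ℂ) :
    star x ⬝ᵥ (Matrix.of fun j k : Fin n => circleCoeff f ((j : ℤ) - k)).mulVec x =
      (2 * Real.pi : ℂ)⁻¹ * ∫ θ in (0 : ℝ)..2 * Real.pi,
        f (circleMap 0 1 θ) * ((‖∑ k : Fin n, x k * circleMap 0 1 θ ^ (k : ℕ)‖ ^ 2 : ℝ) : ℂ) := by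
  have hfc : Continuous fun θ : ℝ => f (circleMap 0 1 θ) :=
    hf.comp_continuous (continuous_circleMap 0 1) fun θ => circleMap_mem_sphere 0 zero_le_one θ
  have h0 : ∀ θ : ℝ, circleMap 0 1 θ ≠ 0 := fun θ => circleMap_ne_center one_ne_zero
  have hcont : ∀ j k : Fin n, Continuous fun θ : ℝ => star (x j) *
      (circleMap 0 1 θ ^ (-((j : ℤ) - k)) * f (circleMap 0 1 θ) * x k) := fun j k =>
    (continuous_const.mul ((((continuous_circleMap 0 1).zpow₀ _ fun θ => Or.inl (h0 θ)).mul
      hfc).mul continuous_const))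
  have hpt : ∀ θ : ℝ, f (circleMap 0 1 θ) *
      ((‖∑ k : Fin n, x k * circleMap 0 1 θ ^ (k : ℕ)‖ ^ 2 : ℝ) : ℂ) =
      ∑ j : Fin n, ∑ k : Fin n, star (x j) *
        (circleMap 0 1 θ ^ (-((j : ℤ) - k)) * f (circleMap 0 1 θ) * x k) := by
    intro θ
    have hconj : (starRingEnd ℂ) (circleMap 0 1 θ) = (circleMap 0 1 θ)⁻¹ := by
      rw [Complex.inv_eq_conj (by simp)]
    push_cast
    rw [← Complex.conj_mul', map_sum, Finset.sum_mul_sum, Finset.mul_sum]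
    refine Finset.sum_congr rfl fun j _ => ?_
    rw [Finset.mul_sum]
    refine Finset.sum_congr rfl fun k _ => ?_
    rw [map_mul, map_pow, hconj, neg_sub, zpow_sub₀ (h0 θ), zpow_natCast, zpow_natCast,
      starRingEnd_apply, inv_pow, div_eq_mul_inv]
    ring
  simp_rw [hpt]
  rw [intervalIntegral.integral_finsetSum fun j _ =>
    (continuous_finsetSum _ fun k _ => hcont j k).intervalIntegrable _ _, Finset.mul_sum]
  simp only [dotProduct, Matrix.mulVec, Matrix.of_apply, Pi.star_apply]
  refine Finset.sum_congr rfl fun j _ => ?_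
  rw [intervalIntegral.integral_finsetSum fun k _ => (hcont j k).intervalIntegrable _ _,
    Finset.mul_sum, Finset.mul_sum]
  refine Finset.sum_congr rfl fun k _ => ?_
  rw [intervalIntegral.integral_const_mul, intervalIntegral.integral_mul_const,
    circleCoeff_eq_intervalIntegral]
  ring

/-- The integral formula for the form, applied to `f` and to the symbol `1`, reduces the bound to
the pointwise inequality `δ ≤ Re f` on the circle. -/
theorem toeplitz_coercive {n : ℕ} {f : ℂ → ℂ} (hf : ContinuousOn f (Metric.sphere 0 1))
    {δ : ℝ} (hδ : ∀ z : ℂ, ‖z‖ = 1 → δ ≤ (f z).re) (x : Fin n → ℂ) :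
    δ * ∑ j, ‖x j‖ ^ 2 ≤
      (star x ⬝ᵥ (Matrix.of fun j k : Fin n => circleCoeff f ((j : ℤ) - k)).mulVec x).re := by
  have hfc : Continuous fun θ : ℝ => f (circleMap 0 1 θ) :=
    hf.comp_continuous (continuous_circleMap 0 1) fun θ => circleMap_mem_sphere 0 zero_le_one θ
  let P : ℝ → ℝ := fun θ => ‖∑ k : Fin n, x k * circleMap 0 1 θ ^ (k : ℕ)‖ ^ 2
  have hP : Continuous P := by
    have := continuous_circleMap 0 1
    fun_prop
  have hre : ∀ g : ℂ → ℂ, (Continuous fun θ : ℝ => g (circleMap 0 1 θ)) →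
      ((2 * Real.pi : ℂ)⁻¹ * ∫ θ in (0 : ℝ)..2 * Real.pi,
        g (circleMap 0 1 θ) * (P θ : ℂ)).re =
      (2 * Real.pi)⁻¹ * ∫ θ in (0 : ℝ)..2 * Real.pi, (g (circleMap 0 1 θ)).re * P θ := by
    intro g hg
    have h1 : (2 * Real.pi : ℂ)⁻¹ = (((2 * Real.pi)⁻¹ : ℝ) : ℂ) := by push_cast; rfl
    have hi : IntervalIntegrable (fun θ : ℝ => g (circleMap 0 1 θ) * (P θ : ℂ))
        MeasureTheory.volume 0 (2 * Real.pi) :=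
      (hg.mul (Complex.continuous_ofReal.comp hP)).intervalIntegrable _ _
    rw [h1, Complex.re_ofReal_mul]
    congr 1
    have := Complex.reCLM.intervalIntegral_comp_comm hi
    simp only [Complex.reCLM_apply, Complex.re_mul_ofReal] at this
    exact this.symm
  have hone : star x ⬝ᵥ (Matrix.of fun j k : Fin n =>
      circleCoeff (fun _ => 1) ((j : ℤ) - k)).mulVec x = ((∑ j, ‖x j‖ ^ 2 : ℝ) : ℂ) := by
    have : (Matrix.of fun j k : Fin n => circleCoeff (fun _ => 1) ((j : ℤ) - k)) = 1 := by
      ext j k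
      simp [circleCoeff_one, Matrix.one_apply, sub_eq_zero, Fin.ext_iff]
    rw [this, Matrix.one_mulVec]
    simp only [dotProduct, Pi.star_apply]
    push_cast
    exact Finset.sum_congr rfl fun j _ => Complex.conj_mul' (x j)
  have h1 := congrArg Complex.re (hone.symm.trans
    (toeplitz_quadraticForm (continuousOn_const (c := (1 : ℂ))) x))
  have h2 := hre (fun _ => 1) continuous_const
  rw [toeplitz_quadraticForm hf, hre f hfc, ← Complex.ofReal_re (∑ j, ‖x j‖ ^ 2), h1, h2,
    mul_left_comm, ← intervalIntegral.integral_const_mul]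
  refine mul_le_mul_of_nonneg_left ?_ (by positivity)
  refine intervalIntegral.integral_mono_on Real.two_pi_pos.le
    (Continuous.intervalIntegrable (by fun_prop) _ _)
    (Continuous.intervalIntegrable ((Complex.continuous_re.comp hfc).mul hP) _ _) fun θ _ => ?_
  rw [Complex.one_re, one_mul]
  exact mul_le_mul_of_nonneg_right (hδ _ (by simp)) (by positivity)

/-! ### Boundary weights -/

/-- The geometric weight `t ^ j + t ^ (n - 1 - j)` measuring the distance of an index to the
boundary of `{0, …, n - 1}`. -/
noncomputable def boundaryWeight (t : ℝ) {n : ℕ} (j : Fin n) : ℝ :=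
  t ^ (j : ℕ) + t ^ (n - 1 - (j : ℕ))

theorem boundaryWeight_pos {t : ℝ} (ht : 0 < t) {n : ℕ} (j : Fin n) : 0 < boundaryWeight t j := by
  unfold boundaryWeight
  positivity

theorem sum_boundaryWeight_le {t : ℝ} (ht0 : 0 ≤ t) (ht1 : t < 1) (n : ℕ) :
    ∑ j : Fin n, boundaryWeight t j ≤ 2 * (1 - t)⁻¹ := by
  have h : ∑ i ∈ Finset.range n, t ^ i ≤ (1 - t)⁻¹ := by
    rw [← tsum_geometric_of_lt_one ht0 ht1]
    exact (summable_geometric_of_lt_one ht0 ht1).sum_le_tsum _ fun i _ => by positivity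
  simp only [boundaryWeight, Finset.sum_add_distrib]
  rw [Fin.sum_univ_eq_sum_range (fun j => t ^ j) n,
    Fin.sum_univ_eq_sum_range (fun j => t ^ (n - 1 - j)) n,
    Finset.sum_range_reflect (fun j => t ^ j) n]
  linarith

/-- For `j ≤ k` the exponent equals `j + (n - 1 - k) + 1`, so one cross term of the product already
dominates; the case `k ≤ j` is symmetric. -/
theorem pow_sub_natAbs_le_boundaryWeight_mul {t : ℝ} (ht0 : 0 < t) (ht1 : t < 1) {n : ℕ}
    (j k : Fin n) :
    t ^ (n - ((j : ℤ) - k).natAbs) ≤ boundaryWeight t j * boundaryWeight t k := by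
  have hj := j.isLt
  have hk := k.isLt
  have hexp : boundaryWeight t j * boundaryWeight t k =
      t ^ ((j : ℕ) + k) + t ^ ((j : ℕ) + (n - 1 - k)) + t ^ ((n - 1 - j) + (k : ℕ)) +
        t ^ ((n - 1 - j) + (n - 1 - (k : ℕ))) := by
    simp only [boundaryWeight, pow_add]
    ring
  have hp : ∀ i : ℕ, 0 < t ^ i := fun i => pow_pos ht0 i
  rw [hexp]
  rcases le_total (j : ℕ) k with h | h
  · have := pow_le_pow_of_le_one ht0.le ht1.le
      (show (j : ℕ) + (n - 1 - k) ≤ n - ((j : ℤ) - k).natAbs by omega)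
    linarith [hp ((j : ℕ) + k), hp ((n - 1 - j) + (k : ℕ)), hp ((n - 1 - j) + (n - 1 - (k : ℕ)))]
  · have := pow_le_pow_of_le_one ht0.le ht1.le
      (show (n - 1 - j) + (k : ℕ) ≤ n - ((j : ℤ) - k).natAbs by omega)
    linarith [hp ((j : ℕ) + k), hp ((j : ℕ) + (n - 1 - k)), hp ((n - 1 - j) + (n - 1 - (k : ℕ)))]

theorem boundaryWeight_le_two {t : ℝ} (ht0 : 0 < t) (ht1 : t < 1) {n : ℕ} (j : Fin n) :
    boundaryWeight t j ≤ 2 := by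
  have h := fun i : ℕ => pow_le_one₀ (n := i) ht0.le ht1.le
  have h1 := h j
  have h2 := h (n - 1 - j)
  unfold boundaryWeight
  linarith

/-- One factor `t` supplies `t ^ (m - n)` and a pair of weights, the other a second pair; the
surplus weight at `j` is bounded by `2`. The square at `k` is what the conjugation argument
consumes. -/
theorem pow_sub_natAbs_le {t : ℝ} (ht0 : 0 < t) (ht1 : t < 1) {n m : ℕ} (hnm : n ≤ m)
    (j k : Fin n) :
    (t * t) ^ (m - ((j : ℤ) - k).natAbs) ≤
      2 * t ^ (m - n) * boundaryWeight t j * boundaryWeight t k ^ 2 := by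
  have hle : m - n + (n - ((j : ℤ) - k).natAbs) = m - ((j : ℤ) - k).natAbs := by
    have := j.isLt
    have := k.isLt
    omega
  have hW := pow_sub_natAbs_le_boundaryWeight_mul ht0 ht1 j k
  have hj := boundaryWeight_pos ht0 j
  have hk := boundaryWeight_pos ht0 k
  have hj2 := boundaryWeight_le_two ht0 ht1 j
  have hsplit : t ^ (m - ((j : ℤ) - k).natAbs) ≤
      t ^ (m - n) * (boundaryWeight t j * boundaryWeight t k) := by
    rw [← hle, pow_add]
    gcongr
  have hW' : t ^ (m - ((j : ℤ) - k).natAbs) ≤ boundaryWeight t j * boundaryWeight t k :=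
    (pow_le_pow_of_le_one ht0.le ht1.le (by omega)).trans hW
  rw [mul_pow]
  calc _ ≤ t ^ (m - n) * (boundaryWeight t j * boundaryWeight t k) *
        (boundaryWeight t j * boundaryWeight t k) := by gcongr
    _ ≤ t ^ (m - n) * (boundaryWeight t j * boundaryWeight t k) * (2 * boundaryWeight t k) := by
        gcongr
    _ = _ := by ring

theorem Real.exp_mul_sub_one_le {B x : ℝ} (hB : 0 ≤ B) (hx0 : 0 ≤ x) (hx1 : x ≤ 1) :
    Real.exp (B * x) - 1 ≤ B * Real.exp B * x := by
  have h1 := Real.add_one_le_exp (-(B * x))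
  have h2 : Real.exp (B * x) * Real.exp (-(B * x)) = 1 := by
    rw [← Real.exp_add, add_neg_cancel, Real.exp_zero]
  have h3 : Real.exp (B * x) ≤ Real.exp B := Real.exp_le_exp.mpr (by nlinarith)
  have h4 : Real.exp (B * x) * (B * x) ≤ Real.exp B * (B * x) :=
    mul_le_mul_of_nonneg_right h3 (by positivity)
  nlinarith [mul_le_mul_of_nonneg_left h1 (Real.exp_pos (B * x)).le]

/-! ### The asymptotic comparison -/

theorem corollary1 (Ω : Set ℂ) (hΩ : IsOpen Ω) (hcircle : Metric.sphere (0 : ℂ) 1 ⊆ Ω)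
    (f : ℂ → ℂ) (hf : AnalyticOnNhd ℂ f Ω)
    (hpos : ∀ z : ℂ, ‖z‖ = 1 → (f z).im = 0 ∧ 0 < (f z).re) :
    ∃ c : ℝ, 0 < c ∧ ∃ C : ℝ, ∃ N : ℕ, ∀ n m : ℕ, N ≤ n → n + N ≤ m →
      ∃ E : ℂ, ‖E‖ ≤ C * Real.exp (-c * ((m : ℝ) - (n : ℝ))) ∧
        discreteToeplitzDet n f (unityRoots m) = continuousToeplitzDet n f * (1 + E) := by
  have hcont : ContinuousOn f (Metric.sphere 0 1) := hf.continuousOn.mono hcircle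
  obtain ⟨δ, hδ, hδf⟩ : ∃ δ : ℝ, 0 < δ ∧ ∀ z : ℂ, ‖z‖ = 1 → δ ≤ (f z).re := by
    obtain ⟨w, hw, hmin⟩ := (isCompact_sphere (0 : ℂ) 1).exists_isMinOn
      ⟨1, by simp⟩ (Complex.continuous_re.comp_continuousOn hcont)
    exact ⟨(f w).re, (hpos w (by simpa using hw)).2, fun z hz => hmin (by simpa using hz)⟩
  obtain ⟨r, hr0, hr1, hrΩ⟩ := exists_annulus_subset_of_sphere_subset hΩ hcircle
  obtain ⟨M, hM, hcoeff⟩ := norm_circleCoeff_le_of_annulus hr0 hr1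
    fun z h1 h2 => hf z (hrΩ z h1 h2)
  -- A fourth root of `r`: one square root is spent on summing the aliasing series, the other on the
  -- two pairs of weights.
  obtain ⟨t, ht0, ht1, rfl⟩ : ∃ t : ℝ, 0 < t ∧ t < 1 ∧ (t * t) * (t * t) = r := by
    have h1 : Real.sqrt r < 1 := by rw [Real.sqrt_lt' one_pos]; simpa using hr1
    refine ⟨√√r, by positivity, by rw [Real.sqrt_lt' one_pos]; simpa using h1, ?_⟩
    rw [Real.mul_self_sqrt (by positivity), Real.mul_self_sqrt hr0.le]
  have hs0 : 0 < t * t := by positivity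
  have hs1 : t * t < 1 := by nlinarith
  set K : ℝ := M * ∑' l : ℤ, (t * t) ^ l.natAbs with hK
  have hK0 : 0 ≤ K := mul_nonneg hM (tsum_nonneg fun l => by positivity)
  have ht1' : 0 < 1 - t := by linarith
  set B : ℝ := δ⁻¹ * (2 * K) * (2 * (1 - t)⁻¹) ^ 3 with hB
  have hB0 : 0 ≤ B := by positivity
  -- With `c = -log t` the target rate is exactly `t ^ (m - n)`; the estimates need only `n ≤ m`, so
  -- `N = 1` suffices.
  refine ⟨-Real.log t, neg_pos.mpr (Real.log_neg ht0 ht1), B * Real.exp B, 1,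
    fun n m _ hnm => ?_⟩
  let T : Matrix (Fin n) (Fin n) ℂ := Matrix.of fun j k => circleCoeff f ((j : ℤ) - k)
  let S : Matrix (Fin n) (Fin n) ℂ := Matrix.of fun j k =>
    ((unityRoots m).card : ℂ)⁻¹ * ∑ z ∈ unityRoots m, z ^ (-((j : ℤ) - k)) * f z
  have hT : continuousToeplitzDet n f = T.det := by
    simp only [continuousToeplitzDet, T, circleCoeff, neg_sub', sub_neg_eq_add]
  have hS : discreteToeplitzDet n f (unityRoots m) = (T + (S - T)).det := by
    rw [add_sub_cancel]
    simp only [discreteToeplitzDet, S, neg_sub', sub_neg_eq_add]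
  obtain ⟨E, hE, hdet⟩ := exists_det_add_eq_det_mul_of_coercive (T := T) (R := S - T)
    (ε := 2 * K * t ^ (m - n)) hδ (toeplitz_coercive hcont hδf)
    (v := boundaryWeight t) (boundaryWeight_pos ht0) fun j k => by
      have h := norm_aliasing_le hcont hs0 hs1 hM hcoeff (m := m) (q := (j : ℤ) - k) (by omega)
      have h' := mul_le_mul_of_nonneg_left (pow_sub_natAbs_le ht0 ht1 (m := m) (by omega) j k) hK0
      exact h.trans (h'.trans (le_of_eq (by ring)))
  refine ⟨E, ?_, by rw [hS, hT, hdet]⟩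
  have hexp : Real.exp (-(-Real.log t) * ((m : ℝ) - n)) = t ^ (m - n) := by
    rw [neg_neg, ← Nat.cast_sub (by omega), Real.exp_mul, Real.exp_log ht0, Real.rpow_natCast]
  rw [hexp]
  refine hE.trans (le_trans ?_ (Real.exp_mul_sub_one_le hB0 (by positivity)
    (pow_le_one₀ ht0.le ht1.le)))
  refine sub_le_sub_right (Real.exp_le_exp.mpr ?_) 1
  have hsum := sum_boundaryWeight_le ht0.le ht1 n
  have hnn : 0 ≤ ∑ j : Fin n, boundaryWeight t j :=
    Finset.sum_nonneg fun j _ => (boundaryWeight_pos ht0 j).le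
  calc _ ≤ δ⁻¹ * (2 * K * t ^ (m - n)) * (2 * (1 - t)⁻¹) ^ 3 := by gcongr
    _ = _ := by rw [hB]; ring
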